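/- Let $p\ge 3$ be an integer, $\beta\ge 0$ and $h\in\mathbb R$. For $N\ge 1$ let $\mathbb P_{\beta,h,p}=\mathbb P^{(N)}_{\beta,h,p}$ be the $p$-tensor Curie–Weiss model on $\{-1,1\}^N$, $$\mathbb P_{\beta,h,p}(X)=\frac{1}{2^N Z_N(\beta,h,p)}\exp\Big\{\frac{\beta}{N^{p-1}}\sum_{1\le i_1,\dots,i_p\le N}X_{i_1}\cdots X_{i_p}+h\sum_{i=1}^N X_i\Big\},$$ where $Z_N(\beta,h,p)$ is the normalizing constant. For $x\in[-1,1]$ let $$H(x)=\beta x^p+hx-\tfrac12\{(1+x)\log(1+x)+(1-x)\log(1-x)\}.$$ Suppose that $(\beta,h)$ is $p$-regular: there is $m_*\in(-1,1)$ with $H(m_*)>H(x)$ for all $x\in[-1,1]\setminus\{m_*\}$, and $H''(m_*)<0$. Let $X\sim\mathbb P_{\beta,h,p}$, assume that $\beta$ is known, and let $\hat h_N=\hat h_N(X)$ be the maximum likelihood estimate of $h$: a maximizer of $t\mapsto\mathbb P_{\beta,t,p}(X)$ over $t\in\mathbb R$ whenever one exists, and an arbitrary real number otherwise. Then, as $N\to\infty$: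 1. with $\mathbb P_{\beta,h,p}$-probability tending to $1$, the likelihood $t\mapsto\mathbb P_{\beta,t,p}(X)$ has exactly one maximizer in $\mathbb R$; 2. $\hat h_N$ is $\sqrt N$-consistent, that is, $\sqrt N(\hat h_N-h)$ is bounded in probability: for every $\varepsilon>0$ there is $M$ with $\mathbb P_{\beta,h,p}\big(|\sqrt N(\hat h_N-h)|>M\big)\le\varepsilon$ for all large $N$; 3. $\sqrt N(\hat h_N-h)\xrightarrow{D}N\big(0,-H''(m_*)\big)$; 4. the limiting variance $-H''(m_*)>0$ equals the limiting inverse Fisher information: with $I_N(h)=\frac1N\,\mathbb E_{\beta,h,p}\big[\big(\frac{\partial}{\partial h}\log\mathbb P_{\beta,h,p}(X)\big)^2\big]$, one has $I_N(h)^{-1}\to -H''(m_*)$. -/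

import Mathlib

open MeasureTheory ProbabilityTheory Filter Topology

namespace CurieWeiss

noncomputable section

/-- A spin configuration `X ∈ {-1, 1}^N`; the two elements of `ℤˣ` are `1` and `-1`. -/
abbrev Config (N : ℕ) : Type := Fin N → ℤˣ

/-- Every subset of `{-1, 1}` is measurable (hence so is every subset of `Config N`). -/
instance instDiscreteSpin : DiscreteMeasurableSpace ℤˣ where
  forall_measurableSet s :=
    ⟨Units.val '' s, MeasurableSet.of_discrete, Set.preimage_image_eq s Units.val_injective⟩

/-- The `i`-th spin as a real number. -/
def spin {N : ℕ} (X : Config N) (i : Fin N) : ℝ := ((X i : ℤ) : ℝ)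

/-- The exponent
`(β / N^(p-1)) ∑_{1 ≤ i₁, …, i_p ≤ N} X_{i₁} ⋯ X_{i_p} + h ∑ᵢ Xᵢ`. -/
def energy (N p : ℕ) (β h : ℝ) (X : Config N) : ℝ :=
  β / (N : ℝ) ^ (p - 1) * ∑ I : Fin p → Fin N, ∏ k, spin X (I k) + h * ∑ i, spin X i

/-- The partition function `Z_N(β, h, p)`. -/
def partitionFn (N p : ℕ) (β h : ℝ) : ℝ :=
  1 / 2 ^ N * ∑ X : Config N, Real.exp (energy N p β h X)

/-- The probability mass `ℙ_{β,h,p}(X)`, which is also the likelihood of `(β, h)` given `X`. -/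
def likelihood (N p : ℕ) (β h : ℝ) (X : Config N) : ℝ :=
  Real.exp (energy N p β h X) / (2 ^ N * partitionFn N p β h)

/-- The `p`-tensor Curie-Weiss model `ℙ_{β,h,p}` on `{-1, 1}^N`. -/
def model (N p : ℕ) (β h : ℝ) : Measure (Config N) :=
  ∑ X : Config N, ENNReal.ofReal (likelihood N p β h X) • Measure.dirac X

theorem partitionFn_pos (N p : ℕ) (β h : ℝ) : 0 < partitionFn N p β h :=
  mul_pos (by positivity) (Finset.sum_pos (fun _ _ => Real.exp_pos _) Finset.univ_nonempty)

theorem likelihood_nonneg (N p : ℕ) (β h : ℝ) (X : Config N) : 0 ≤ likelihood N p β h X :=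
  div_nonneg (Real.exp_pos _).le (mul_nonneg (by positivity) (partitionFn_pos N p β h).le)

theorem sum_likelihood (N p : ℕ) (β h : ℝ) : ∑ X : Config N, likelihood N p β h X = 1 := by
  have hZ : (2 : ℝ) ^ N * partitionFn N p β h = ∑ X : Config N, Real.exp (energy N p β h X) := by
    unfold partitionFn
    field_simp
  have h0 : (2 : ℝ) ^ N * partitionFn N p β h ≠ 0 :=
    mul_ne_zero (by positivity) (partitionFn_pos N p β h).ne'
  unfold likelihood
  rw [← Finset.sum_div, ← hZ, div_self h0]

instance instIsProbabilityMeasureModel (N p : ℕ) (β h : ℝ) :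
    IsProbabilityMeasure (model N p β h) where
  measure_univ := by
    simp only [model, Measure.coe_finsetSum, Finset.sum_apply, Measure.smul_apply,
      measure_univ, smul_eq_mul, mul_one]
    rw [← ENNReal.ofReal_sum_of_nonneg (fun X _ => likelihood_nonneg N p β h X),
      sum_likelihood, ENNReal.ofReal_one]

/-- The binary entropy function `I(x) = ((1+x) log (1+x) + (1-x) log (1-x)) / 2`. -/
def binEntropy (x : ℝ) : ℝ :=
  1 / 2 * ((1 + x) * Real.log (1 + x) + (1 - x) * Real.log (1 - x))

/-- `H_{β,h,p}(x) = β x^p + h x - I(x)`. Only its values and derivatives on `[-1, 1]` matter. -/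
def H (p : ℕ) (β h : ℝ) (x : ℝ) : ℝ := β * x ^ p + h * x - binEntropy x

/-- The second derivative of `H_{β,h,p}` (used at interior points of `[-1, 1]` only). -/
def H'' (p : ℕ) (β h : ℝ) (x : ℝ) : ℝ := iteratedDeriv 2 (H p β h) x

/-- `m ∈ (-1, 1)` is the unique global maximizer of `H_{β,h,p}` on `[-1, 1]`. -/
def IsUniqueMaximizer (p : ℕ) (β h m : ℝ) : Prop :=
  m ∈ Set.Ioo (-1 : ℝ) 1 ∧ ∀ x ∈ Set.Icc (-1 : ℝ) 1, x ≠ m → H p β h x < H p β h m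

/-- The point `(β, h)` is `p`-regular. -/
def IsPRegular (p : ℕ) (β h : ℝ) : Prop :=
  ∃ m : ℝ, IsUniqueMaximizer p β h m ∧ H'' p β h m < 0

/-- `h'` maximizes the likelihood of the observation `X` over all `h' ∈ ℝ`, where `β` is known. -/
def IsLikelihoodMaximizer (N p : ℕ) (β : ℝ) (X : Config N) (h' : ℝ) : Prop :=
  ∀ t : ℝ, likelihood N p β t X ≤ likelihood N p β h' X

/-- `hHat` is a maximum likelihood estimator of `h` when `β` is known: it picks a maximizer of the
likelihood whenever there is one. Where the likelihood has no maximizer in `ℝ` (as when all spins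
agree), its value is an arbitrary real number. -/
def IsMLE (N p : ℕ) (β : ℝ) (hHat : Config N → ℝ) : Prop :=
  ∀ X : Config N, (∃ h' : ℝ, IsLikelihoodMaximizer N p β X h') →
    IsLikelihoodMaximizer N p β X (hHat X)

/-- The Fisher information of `h`, scaled by `N`:
`I_N(h) = N⁻¹ 𝔼_{β,h,p} [(∂/∂h log ℙ_{β,h,p}(X))²]`. -/
def fisherInfo (N p : ℕ) (β h : ℝ) : ℝ :=
  1 / (N : ℝ) *
    ∫ X, (deriv (fun t : ℝ => Real.log (likelihood N p β t X)) h) ^ 2 ∂(model N p β h)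

end

end CurieWeiss

/-!
The model depends on a configuration only through the number `k` of its spins equal to `1`, that
is, through the magnetization `x = (2k - N) / N` (`magnetization`), and by Stirling's formula the
total weight of the configurations with a given `k` is about `N ^ (-1/2) exp (N H(x))`. As `H` has
a strict, nondegenerate maximum at `m`, Laplace's method (`exists_tendsto_sum_weight`) shows that
the scaled magnetization `W = √N (x - m)` (`scaledMag`) is asymptotically normal with mean `0` and
variance `v = -1 / H''(m)`. This holds for all test functions of exponential growth, and even for
test functions that vary with `N` (`tendsto_integral_upCount`). Every limit below is an instance.

The score is `∂/∂h log ℙ(X) = √N (W(X) - 𝔼 W)` (`deriv_log_likelihood`), so that the Fisher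
information `I_N(h)` is the variance of `W` and tends to `v`.

The inverse of the likelihood is a sum of exponentials in the field, hence convex. It is strictly
convex and coercive unless all spins agree, an event whose probability tends to `0`; so there is
a unique maximum likelihood estimate off that event. The derivative of the inverse likelihood at
`h + x / √N` has the sign of `𝔼 [W exp (x W)] - w 𝔼 [exp (x W)]`, where `w` is the observed value
of `W` (`invLikelihoodDeriv_eq`). If `w` converges as `N → ∞`, this sign is eventually that of
`v x - w`; hence `√N (ĥ - h)` tends to `w / v` (`tendsto_sqrt_mul_maximizer_sub`). As the
test functions may vary with `N`, this turns the limit theorem for `W` into the convergence in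
distribution of `√N (ĥ - h)` to `N(0, v) / v = N(0, 1 / v)`; boundedness in probability follows.
-/

namespace CurieWeiss

/-! ### Binomial probabilities at their mean -/

/-- The probability that a binomial variable with parameters `N` and `k / N` equals its mean `k`,
that is, `C(N, k) (k / N) ^ k (1 - k / N) ^ (N - k)`. -/
noncomputable def binomAtMean (N k : ℕ) : ℝ :=
  N.choose k * ((k : ℝ) / N) ^ k * (((N - k : ℕ) : ℝ) / N) ^ (N - k)

theorem binomAtMean_nonneg (N k : ℕ) : 0 ≤ binomAtMean N k := by
  unfold binomAtMean; positivity

theorem binomAtMean_le_one {N k : ℕ} (hk : k ≤ N) : binomAtMean N k ≤ 1 := by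
  rcases Nat.eq_zero_or_pos N with rfl | hN
  · simp [binomAtMean, Nat.le_zero.mp hk]
  have hN' : (N : ℝ) ≠ 0 := by positivity
  have h1 : ((k : ℝ) / N + ((N - k : ℕ) : ℝ) / N) ^ N = 1 := by
    rw [Nat.cast_sub hk, ← add_div, add_sub_cancel, div_self hN', one_pow]
  rw [add_pow] at h1
  rw [← h1]
  refine le_trans (le_of_eq ?_) (Finset.single_le_sum (f := fun m => ((k : ℝ) / N) ^ m *
    (((N - k : ℕ) : ℝ) / N) ^ (N - m) * (N.choose m : ℝ)) (fun i _ => by positivity)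
    (Finset.mem_range.mpr (Nat.lt_succ_of_le hk)))
  unfold binomAtMean
  ring

theorem factorial_eq_stirlingSeq {n : ℕ} (hn : 0 < n) :
    (n.factorial : ℝ) = Stirling.stirlingSeq n * (√(2 * n : ℝ) * (n / Real.exp 1) ^ n) := by
  have : √(2 * n : ℝ) * (n / Real.exp 1) ^ n ≠ 0 := by positivity
  rw [Stirling.stirlingSeq, div_mul_cancel₀ _ this]

theorem stirlingSeq_pos {n : ℕ} (hn : 0 < n) : 0 < Stirling.stirlingSeq n := by
  obtain ⟨m, rfl⟩ := Nat.exists_eq_succ_of_ne_zero hn.ne'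
  exact Stirling.stirlingSeq'_pos m

/-- The powers in Stirling's formula cancel, so that `√N * binomAtMean N k` is governed by
the Stirling ratios and by `k / N` alone. -/
theorem sqrt_mul_binomAtMean {N k : ℕ} (hk : 0 < k) (hkN : k < N) :
    √(N : ℝ) * binomAtMean N k =
      Stirling.stirlingSeq N / (Stirling.stirlingSeq k * Stirling.stirlingSeq (N - k)) *
        (√(2 * ((k : ℝ) / N) * (1 - (k : ℝ) / N)))⁻¹ := by
  obtain ⟨l, rfl⟩ := Nat.exists_eq_add_of_lt hkN
  have hsub : k + l + 1 - k = l + 1 := by omega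
  have hch : (((k + l + 1).choose k : ℕ) : ℝ) =
      ((k + l + 1).factorial : ℝ) / (k.factorial * (l + 1).factorial) := by
    rw [Nat.cast_choose ℝ (by omega), hsub]
  unfold binomAtMean
  rw [hsub, hch, factorial_eq_stirlingSeq (by omega : 0 < k + l + 1), factorial_eq_stirlingSeq hk,
    factorial_eq_stirlingSeq (by omega : 0 < l + 1)]
  have ha := (stirlingSeq_pos hk).ne'
  have hb := (stirlingSeq_pos (by omega : 0 < l + 1)).ne'
  have hl : (0 : ℝ) < ((l + 1 : ℕ) : ℝ) := by positivity
  have hk' : (0 : ℝ) < (k : ℝ) := by positivity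
  have hNeq : ((k + l + 1 : ℕ) : ℝ) = (k : ℝ) + ((l + 1 : ℕ) : ℝ) := by push_cast; ring
  have hpow : k + l + 1 = k + (l + 1) := by ring
  generalize Stirling.stirlingSeq (k + l + 1) = c
  generalize Stirling.stirlingSeq k = a at *
  generalize Stirling.stirlingSeq (l + 1) = b at *
  rw [hNeq, hpow]
  generalize ((l + 1 : ℕ) : ℝ) = y at *
  generalize (k : ℝ) = x at *
  generalize l + 1 = j
  have hxy : 0 < x + y := by positivity
  have h1 : 2 * (x / (x + y)) * (1 - x / (x + y)) = (2 * x) * (2 * y) / ((2 * (x + y)) * (x + y)) := by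
    field_simp; ring
  rw [h1, Real.sqrt_div (by positivity), Real.sqrt_mul (by positivity) (2 * y),
    Real.sqrt_mul (by positivity) (x + y)]
  have e := Real.exp_pos 1
  have s1 : √(2 * x) ≠ 0 := by positivity
  have s2 : √(2 * y) ≠ 0 := by positivity
  simp only [div_pow, pow_add]
  field_simp
  rw [Real.sqrt_mul (by positivity), Real.sqrt_sq hxy.le, Real.sq_sqrt hxy.le]
  ring

/-- Away from the two endpoints, a binomial variable hits its mean with probability
`O(1 / √N)`. -/
theorem exists_sqrt_mul_binomAtMean_le {δ : ℝ} (hδ : 0 < δ) :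
    ∃ C : ℝ, 0 ≤ C ∧ ∀ N k : ℕ, 0 < N → δ ≤ (k : ℝ) / N → δ ≤ 1 - (k : ℝ) / N →
      √(N : ℝ) * binomAtMean N k ≤ C := by
  refine ⟨Stirling.stirlingSeq 1 / (√Real.pi * √Real.pi) * (√(2 * δ * δ))⁻¹,
    by have := stirlingSeq_pos one_pos; positivity, fun N k hN h1 h2 => ?_⟩
  have hN' : (0 : ℝ) < N := by positivity
  have hk : 0 < k := by
    rcases Nat.eq_zero_or_pos k with rfl | h
    · simp at h1; linarith
    · exact h
  have hkN : k < N := by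
    have : (k : ℝ) / N < 1 := by linarith
    rw [div_lt_one hN'] at this
    exact_mod_cast this
  rw [sqrt_mul_binomAtMean hk hkN]
  have hanti : Stirling.stirlingSeq N ≤ Stirling.stirlingSeq 1 := by
    obtain ⟨n, rfl⟩ := Nat.exists_eq_succ_of_ne_zero hN.ne'
    exact Stirling.stirlingSeq'_antitone (Nat.zero_le n)
  have hp : 0 < √Real.pi := by positivity
  have := stirlingSeq_pos one_pos
  have := stirlingSeq_pos hk
  have := stirlingSeq_pos (Nat.sub_pos_of_lt hkN)
  gcongr
  · exact Stirling.sqrt_pi_le_stirlingSeq hk.ne'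
  · exact Stirling.sqrt_pi_le_stirlingSeq (Nat.sub_pos_of_lt hkN).ne'

/-- The local limit theorem at the mean. -/
theorem tendsto_sqrt_mul_binomAtMean {q : ℝ} (hq0 : 0 < q) (hq1 : q < 1) {k : ℕ → ℕ}
    (hk : Tendsto (fun N : ℕ => (k N : ℝ) / N) atTop (𝓝 q)) :
    Tendsto (fun N : ℕ => √(N : ℝ) * binomAtMean N (k N)) atTop
      (𝓝 (√Real.pi / (√Real.pi * √Real.pi) * (√(2 * q * (1 - q)))⁻¹)) := by
  have hN : Tendsto (fun N : ℕ => (N : ℝ)) atTop atTop := tendsto_natCast_atTop_atTop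
  have hkpos : ∀ᶠ N : ℕ in atTop, 0 < k N ∧ k N < N := by
    filter_upwards [hk.eventually (lt_mem_nhds hq0), hk.eventually (gt_mem_nhds hq1),
      eventually_gt_atTop 0] with N h1 h2 h3
    have h3' : (0 : ℝ) < N := by positivity
    refine ⟨?_, ?_⟩
    · by_contra h
      simp [Nat.eq_zero_of_not_pos h] at h1
    · rw [div_lt_one h3'] at h2
      exact_mod_cast h2
  have hk1 : Tendsto k atTop atTop := by
    rw [← tendsto_natCast_atTop_iff (R := ℝ)]
    refine (hk.pos_mul_atTop hq0 hN).congr' ?_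
    filter_upwards [eventually_gt_atTop 0] with N h3
    field_simp
  have hk2 : Tendsto (fun N => N - k N) atTop atTop := by
    rw [← tendsto_natCast_atTop_iff (R := ℝ)]
    refine ((hk.const_sub 1).pos_mul_atTop (by linarith) hN).congr' ?_
    filter_upwards [eventually_gt_atTop 0, hkpos] with N h3 h4
    rw [Nat.cast_sub h4.2.le]
    field_simp
  have hS := Stirling.tendsto_stirlingSeq_sqrt_pi
  have hsp : √Real.pi ≠ 0 := by positivity
  have hsq : √(2 * q * (1 - q)) ≠ 0 := by
    have : 0 < 1 - q := by linarith
    positivity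
  refine Tendsto.congr' ?_ ((hS.div ((hS.comp hk1).mul (hS.comp hk2)) (mul_ne_zero hsp hsp)).mul
    ((((hk.const_mul 2).mul (hk.const_sub 1)).sqrt).inv₀ hsq))
  filter_upwards [hkpos] with N h
  rw [sqrt_mul_binomAtMean h.1 h.2]
  rfl

/-- The magnetization `(2 k - N) / N` of a configuration of `N` spins, `k` of which are `1`. -/
noncomputable def magnetization (N k : ℕ) : ℝ := (2 * (k : ℝ) - N) / N

theorem magnetization_mem_Icc {N k : ℕ} (hk : k ≤ N) :
    magnetization N k ∈ Set.Icc (-1 : ℝ) 1 := by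
  rcases Nat.eq_zero_or_pos N with rfl | hN
  · simp [magnetization]
  have hN' : (0 : ℝ) < N := by positivity
  have hk' : (k : ℝ) ≤ N := by exact_mod_cast hk
  have hk0 : (0 : ℝ) ≤ k := by positivity
  rw [magnetization, Set.mem_Icc, le_div_iff₀ hN', div_le_iff₀ hN']
  constructor <;> linarith

theorem choose_eq_binomAtMean_mul_exp {N k : ℕ} (hN : 0 < N) (hk : k ≤ N) :
    (N.choose k : ℝ) =
      2 ^ N * (binomAtMean N k * Real.exp (-(N * binEntropy (magnetization N k)))) := by
  have hN' : (0 : ℝ) < N := by positivity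
  have key : ∀ n : ℕ, Real.exp (-(n * Real.log (2 * ((n : ℝ) / N)))) * (2 * ((n : ℝ) / N)) ^ n
      = 1 := by
    intro n
    rcases Nat.eq_zero_or_pos n with rfl | hn
    · simp
    have h2 : 0 < 2 * ((n : ℝ) / N) := by positivity
    rw [← Real.log_pow, Real.exp_neg, Real.exp_log (by positivity), inv_mul_cancel₀ (by positivity)]
  have h1 : 1 + magnetization N k = 2 * ((k : ℝ) / N) := by
    rw [magnetization]; field_simp; ring
  have h2 : 1 - magnetization N k = 2 * (((N - k : ℕ) : ℝ) / N) := by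
    rw [magnetization, Nat.cast_sub hk]; field_simp; ring
  have h3 : -(N * binEntropy (magnetization N k)) =
      -(k * Real.log (2 * ((k : ℝ) / N))) +
        -((N - k : ℕ) * Real.log (2 * (((N - k : ℕ) : ℝ) / N))) := by
    rw [binEntropy, h1, h2]; field_simp; ring
  have h4 : (2 : ℝ) ^ N = 2 ^ k * 2 ^ (N - k) := by rw [← pow_add, Nat.add_sub_cancel' hk]
  rw [h3, Real.exp_add, binomAtMean, h4]
  have e1 := key k
  have e2 := key (N - k)
  rw [mul_pow] at e1 e2
  linear_combination (-(N.choose k : ℝ)) * e1 - (N.choose k : ℝ) *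
    (Real.exp (-(k * Real.log (2 * ((k : ℝ) / N)))) * (2 ^ k * ((k : ℝ) / N) ^ k)) * e2

/-! ### Quadratic behaviour of `H` at its maximizer -/

section

theorem contDiffOn_H (p : ℕ) (β h : ℝ) : ContDiffOn ℝ 2 (H p β h) (Set.Ioo (-1) 1) := by
  intro x hx
  have h1 : (1 + x) ≠ 0 := by have := hx.1; linarith
  have h2 : (1 - x) ≠ 0 := by have := hx.2; linarith
  unfold H binEntropy
  refine ContDiffAt.contDiffWithinAt ?_
  have e1 : ContDiffAt ℝ 2 (fun x : ℝ => 1 + x) x := by fun_prop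
  have e2 : ContDiffAt ℝ 2 (fun x : ℝ => 1 - x) x := by fun_prop
  have e3 : ContDiffAt ℝ 2 (fun x : ℝ => β * x ^ p + h * x) x := by fun_prop
  exact e3.sub (contDiffAt_const.mul ((e1.mul (e1.log h1)).add (e2.mul (e2.log h2))))

theorem continuous_H (p : ℕ) (β h : ℝ) : Continuous (H p β h) := by
  unfold H binEntropy
  have e1 : Continuous fun x : ℝ => (1 + x) * Real.log (1 + x) :=
    Real.continuous_mul_log.comp (by fun_prop : Continuous fun x : ℝ => 1 + x)
  have e2 : Continuous fun x : ℝ => (1 - x) * Real.log (1 - x) :=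
    Real.continuous_mul_log.comp (by fun_prop : Continuous fun x : ℝ => 1 - x)
  fun_prop

variable {p : ℕ} {β h m : ℝ}

theorem deriv_H_eq_zero (hm : IsUniqueMaximizer p β h m) : deriv (H p β h) m = 0 := by
  refine IsLocalMax.deriv_eq_zero ?_
  filter_upwards [isOpen_Ioo.mem_nhds hm.1] with x hx
  rcases eq_or_ne x m with rfl | hne
  · exact le_rfl
  · exact (hm.2 x (Set.Ioo_subset_Icc_self hx) hne).le

theorem H_sub_isLittleO (hm : IsUniqueMaximizer p β h m) :
    (fun x => H p β h x - H p β h m - H'' p β h m / 2 * (x - m) ^ 2) =o[𝓝 m]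
      fun x => (x - m) ^ 2 := by
  have ht := taylor_isLittleO (convex_Ioo (-1 : ℝ) 1) hm.1 (contDiffOn_H p β h)
  rw [isOpen_Ioo.nhdsWithin_eq hm.1] at ht
  refine ht.congr_left fun x => ?_
  rw [taylorWithinEval_succ, taylorWithinEval_succ, taylor_within_zero_eval,
    iteratedDerivWithin_of_isOpen isOpen_Ioo hm.1, iteratedDerivWithin_of_isOpen isOpen_Ioo hm.1]
  simp [deriv_H_eq_zero hm, H'']
  ring

theorem exists_H_sub_le (hm : IsUniqueMaximizer p β h m) (h2 : H'' p β h m < 0) :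
    ∃ κ : ℝ, 0 < κ ∧ ∀ x ∈ Set.Icc (-1 : ℝ) 1, H p β h x - H p β h m ≤ -κ * (x - m) ^ 2 := by
  have hlo := (H_sub_isLittleO hm).def (c := -H'' p β h m / 4) (by linarith)
  obtain ⟨δ, hδ, hball⟩ := Metric.eventually_nhds_iff.mp hlo
  have hK : IsCompact (Set.Icc (-1 : ℝ) 1 \ Metric.ball m δ) :=
    isCompact_Icc.diff Metric.isOpen_ball
  obtain ⟨η, hη, hfar⟩ : ∃ η : ℝ, 0 < η ∧ ∀ x ∈ Set.Icc (-1 : ℝ) 1 \ Metric.ball m δ,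
      H p β h x - H p β h m ≤ -η := by
    rcases (Set.Icc (-1 : ℝ) 1 \ Metric.ball m δ).eq_empty_or_nonempty with he | hne
    · exact ⟨1, one_pos, by simp [he]⟩
    obtain ⟨x₀, hx₀, hmax⟩ := hK.exists_isMaxOn hne (continuous_H p β h).continuousOn
    refine ⟨H p β h m - H p β h x₀, ?_, fun x hx => ?_⟩
    · have : x₀ ≠ m := by
        rintro rfl
        exact hx₀.2 (Metric.mem_ball_self hδ)
      linarith [hm.2 x₀ hx₀.1 this]
    · have : H p β h x ≤ H p β h x₀ := hmax hx
      linarith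
  refine ⟨min (-H'' p β h m / 4) (η / 4), lt_min (by linarith) (by linarith), fun x hx => ?_⟩
  have hsq : 0 ≤ (x - m) ^ 2 := sq_nonneg _
  by_cases hxb : dist x m < δ
  · have := hball hxb
    rw [Real.norm_eq_abs, Real.norm_eq_abs, abs_of_nonneg hsq] at this
    have h3 := (abs_le.mp this).2
    have h4 := mul_le_mul_of_nonneg_right (min_le_left (-H'' p β h m / 4) (η / 4)) hsq
    linarith
  · have h3 := hfar x ⟨hx, hxb⟩
    have h4 := mul_le_mul_of_nonneg_right (min_le_right (-H'' p β h m / 4) (η / 4)) hsq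
    have h5 : (x - m) ^ 2 ≤ 4 := by
      have := hm.1.1; have := hm.1.2; have := hx.1; have := hx.2
      nlinarith
    nlinarith

theorem tendsto_mul_H_sub (hm : IsUniqueMaximizer p β h m) {x : ℕ → ℝ} {y : ℝ}
    (hx : Tendsto (fun N : ℕ => √(N : ℝ) * (x N - m)) atTop (𝓝 y)) :
    Tendsto (fun N : ℕ => N * (H p β h (x N) - H p β h m)) atTop
      (𝓝 (H'' p β h m / 2 * y ^ 2)) := by
  have hsq : Tendsto (fun N : ℕ => √(N : ℝ)) atTop atTop :=
    Real.tendsto_sqrt_atTop.comp tendsto_natCast_atTop_atTop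
  have hxm : Tendsto x atTop (𝓝 m) := by
    have h1 : Tendsto (fun N : ℕ => (√(N : ℝ))⁻¹ * (√(N : ℝ) * (x N - m)) + m) atTop
        (𝓝 (0 * y + m)) := (hsq.inv_tendsto_atTop.mul hx).add_const m
    rw [zero_mul, zero_add] at h1
    refine h1.congr' ?_
    filter_upwards [eventually_gt_atTop 0] with N hN
    have : √(N : ℝ) ≠ 0 := by positivity
    field_simp
    ring
  have hNsq : ∀ N : ℕ, (N : ℝ) * (x N - m) ^ 2 = (√(N : ℝ) * (x N - m)) ^ 2 := fun N => by
    rw [mul_pow, Real.sq_sqrt (Nat.cast_nonneg N)]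
  have hlo := ((H_sub_isLittleO hm).comp_tendsto hxm)
  have hbig := (Asymptotics.isBigO_refl (fun N : ℕ => (N : ℝ)) atTop).mul_isLittleO hlo
  have hO : (fun N : ℕ => (N : ℝ) * ((fun x => (x - m) ^ 2) ∘ x) N) =O[atTop]
      fun _ => (1 : ℝ) := by
    simp only [Function.comp_apply, hNsq]
    exact (hx.pow 2).isBigO_one ℝ
  have h0 := (Asymptotics.isLittleO_one_iff ℝ).mp (hbig.trans_isBigO hO)
  have := h0.add ((hx.pow 2).const_mul (H'' p β h m / 2))
  rw [zero_add] at this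
  refine this.congr fun N => ?_
  rw [← hNsq]
  simp only [Function.comp_apply]
  ring

theorem IsUniqueMaximizer.unique {m' : ℝ} (hm : IsUniqueMaximizer p β h m)
    (hm' : IsUniqueMaximizer p β h m') : m = m' := by
  by_contra hne
  have h1 := hm.2 m' (Set.Ioo_subset_Icc_self hm'.1) (Ne.symm hne)
  have h2 := hm'.2 m (Set.Ioo_subset_Icc_self hm.1) hne
  exact lt_asymm h1 h2

end

/-! ### Laplace's method for lattice sums -/

section

/-- The step function equal to `a k` on `[k, k + 1)` for `k < n`, and to `0` elsewhere. -/
noncomputable def latticeStep (n : ℕ) (a : ℕ → ℝ) (t : ℝ) : ℝ :=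
  ∑ k ∈ Finset.range n, Set.indicator (Set.Ico (k : ℝ) (k + 1)) (fun _ => a k) t

theorem measurable_latticeStep (n : ℕ) (a : ℕ → ℝ) : Measurable (latticeStep n a) := by
  unfold latticeStep
  exact Finset.measurable_fun_sum _ fun k _ => measurable_const.indicator measurableSet_Ico

theorem integral_latticeStep (n : ℕ) (a : ℕ → ℝ) :
    ∫ t, latticeStep n a t = ∑ k ∈ Finset.range n, a k := by
  unfold latticeStep
  rw [integral_finsetSum]
  · refine Finset.sum_congr rfl fun k _ => ?_
    rw [integral_indicator measurableSet_Ico]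
    simp
  · intro k _
    rw [integrable_indicator_iff measurableSet_Ico]
    exact integrableOn_const (by simp)

theorem latticeStep_eq (n : ℕ) (a : ℕ → ℝ) (t : ℝ) :
    latticeStep n a t = if 0 ≤ t ∧ ⌊t⌋₊ < n then a ⌊t⌋₊ else 0 := by
  have hmem : ∀ k : ℕ, t ∈ Set.Ico (k : ℝ) (k + 1) ↔ 0 ≤ t ∧ ⌊t⌋₊ = k := by
    intro k
    constructor
    · intro h
      have h0 : 0 ≤ t := (Nat.cast_nonneg k).trans h.1
      exact ⟨h0, (Nat.floor_eq_iff h0).mpr h⟩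
    · rintro ⟨h0, h⟩
      exact (Nat.floor_eq_iff h0).mp h
  unfold latticeStep
  simp only [Set.indicator_apply, hmem]
  by_cases h0 : 0 ≤ t
  · simp [h0]
  · simp [h0]

/-- The magnetization centered at `m` and scaled by `√N`. -/
noncomputable def scaledMag (m : ℝ) (N k : ℕ) : ℝ := √(N : ℝ) * (magnetization N k - m)

/-- The affine map that sends a value of the scaled magnetization to the number of spins `1`. -/
noncomputable def spinCount (m : ℝ) (N : ℕ) (y : ℝ) : ℝ := N * (1 + m) / 2 + √(N : ℝ) / 2 * y

theorem abs_scaledMag_floor_sub_le {m : ℝ} {N : ℕ} (hN : 0 < N) {y : ℝ}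
    (h0 : 0 ≤ spinCount m N y) :
    |scaledMag m N ⌊spinCount m N y⌋₊ - y| ≤ 2 / √(N : ℝ) := by
  have hs : 0 < √(N : ℝ) := by positivity
  have hsq : √(N : ℝ) ^ 2 = N := Real.sq_sqrt (Nat.cast_nonneg N)
  have h1 := Nat.floor_le h0
  have h2 := Nat.lt_floor_add_one (spinCount m N y)
  have key : scaledMag m N ⌊spinCount m N y⌋₊ - y =
      2 / √(N : ℝ) * ((⌊spinCount m N y⌋₊ : ℝ) - spinCount m N y) := by
    generalize (⌊spinCount m N y⌋₊ : ℕ) = k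
    unfold scaledMag magnetization spinCount
    generalize √(N : ℝ) = s at *
    rw [← hsq]
    field_simp
    ring
  rw [key, abs_mul, abs_of_pos (by positivity : 0 < 2 / √(N : ℝ))]
  refine mul_le_of_le_one_right (by positivity) (abs_le.mpr ⟨by linarith, by linarith⟩)

/-- Gaussian decay absorbs exponential growth, uniformly over unit-size shifts. -/
theorem exists_gaussian_bound {κ : ℝ} (hκ : 0 < κ) {A C E : ℝ} (B : ℝ) (hA : 0 ≤ A)
    (hC : 0 ≤ C) (hE : 0 ≤ E) :
    ∃ D : ℝ, ∀ w y : ℝ, |w - y| ≤ 2 →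
      (C + E * |w|) * (Real.exp (-κ * w ^ 2) * (A * Real.exp (B * |w|))) ≤
        D * Real.exp (-(κ / 4) * y ^ 2) := by
  refine ⟨(C + E) * A * (Real.exp ((B + 1) ^ 2 / (2 * κ)) * Real.exp (2 * κ)), fun w y hwy => ?_⟩
  have h1 : C + E * |w| ≤ (C + E) * Real.exp |w| := by
    have h3 := Real.add_one_le_exp |w|
    have h4 := abs_nonneg w
    nlinarith
  have hw2 : w ^ 2 = |w| ^ 2 := (sq_abs w).symm
  have h5 : (B + 1) * |w| ≤ κ / 2 * w ^ 2 + (B + 1) ^ 2 / (2 * κ) := by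
    have : 0 ≤ (κ * |w| - (B + 1)) ^ 2 / (2 * κ) := by positivity
    have h6 : (κ * |w| - (B + 1)) ^ 2 / (2 * κ) =
        κ / 2 * |w| ^ 2 - (B + 1) * |w| + (B + 1) ^ 2 / (2 * κ) := by
      field_simp; ring
    rw [hw2]; linarith
  have h7 : y ^ 2 ≤ 2 * w ^ 2 + 8 := by
    have := abs_le.mp hwy
    nlinarith [sq_nonneg (w + (w - y)), sq_nonneg (w - (w - y)), this.1, this.2]
  calc (C + E * |w|) * (Real.exp (-κ * w ^ 2) * (A * Real.exp (B * |w|)))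
      ≤ (C + E) * Real.exp |w| * (Real.exp (-κ * w ^ 2) * (A * Real.exp (B * |w|))) := by gcongr
    _ = (C + E) * A * Real.exp (|w| + -κ * w ^ 2 + B * |w|) := by
        rw [Real.exp_add, Real.exp_add]; ring
    _ ≤ (C + E) * A * Real.exp ((B + 1) ^ 2 / (2 * κ) + 2 * κ + -(κ / 4) * y ^ 2) := by
        refine mul_le_mul_of_nonneg_left (Real.exp_le_exp.mpr ?_) (by positivity)
        nlinarith
    _ = _ := by rw [Real.exp_add, Real.exp_add]; ring

variable {p : ℕ} {β h m : ℝ}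

/-- The unnormalized weight of all configurations with `k` spins equal to `1`. -/
noncomputable def weight (p : ℕ) (β h m : ℝ) (N k : ℕ) : ℝ :=
  binomAtMean N k * Real.exp (N * (H p β h (magnetization N k) - H p β h m))

theorem weight_nonneg (p : ℕ) (β h m : ℝ) (N k : ℕ) : 0 ≤ weight p β h m N k :=
  mul_nonneg (binomAtMean_nonneg N k) (Real.exp_pos _).le

/-- Near `m` Stirling's formula gains the factor `1 / √N`; far from `m` the scaled magnetization
is itself of order `√N`. -/
theorem exists_sqrt_mul_weight_le (hm : IsUniqueMaximizer p β h m) (h2 : H'' p β h m < 0) :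
    ∃ κ C E : ℝ, 0 < κ ∧ 0 ≤ C ∧ 0 ≤ E ∧ ∀ N k : ℕ, 0 < N → k ≤ N →
      √(N : ℝ) * weight p β h m N k ≤
        (C + E * |scaledMag m N k|) * Real.exp (-κ * scaledMag m N k ^ 2) := by
  obtain ⟨κ, hκ, hH⟩ := exists_H_sub_le hm h2
  set δ : ℝ := min (1 + m) (1 - m) / 2 with hδdef
  have hδ : 0 < δ := by
    have := hm.1.1; have := hm.1.2
    have : 0 < min (1 + m) (1 - m) := lt_min (by linarith) (by linarith)
    positivity
  have hδ1 : 2 * δ ≤ 1 + m := by have := min_le_left (1 + m) (1 - m); linarith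
  have hδ2 : 2 * δ ≤ 1 - m := by have := min_le_right (1 + m) (1 - m); linarith
  obtain ⟨C, hC, hR⟩ := exists_sqrt_mul_binomAtMean_le (half_pos hδ)
  refine ⟨κ, C, 1 / δ, hκ, hC, by positivity, fun N k hN hk => ?_⟩
  have hN' : (0 : ℝ) < N := by positivity
  have hs : 0 < √(N : ℝ) := by positivity
  have hx := magnetization_mem_Icc hk
  have hexp : Real.exp (N * (H p β h (magnetization N k) - H p β h m)) ≤
      Real.exp (-κ * scaledMag m N k ^ 2) := by
    rw [scaledMag, mul_pow, Real.sq_sqrt hN'.le]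
    have := mul_le_mul_of_nonneg_left (hH _ hx) hN'.le
    exact Real.exp_le_exp.mpr (by linarith)
  have hbin : √(N : ℝ) * binomAtMean N k ≤ C + 1 / δ * |scaledMag m N k| := by
    have hkN : (k : ℝ) / N = (1 + magnetization N k) / 2 := by
      unfold magnetization; field_simp; ring
    by_cases hc : |magnetization N k - m| ≤ δ
    · have hc' := abs_le.mp hc
      have := hR N k hN (by rw [hkN]; linarith) (by rw [hkN]; linarith)
      have : 0 ≤ 1 / δ * |scaledMag m N k| := by positivity
      linarith
    · have h3 : √(N : ℝ) * δ ≤ |scaledMag m N k| := by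
        rw [scaledMag, abs_mul, abs_of_pos hs]
        gcongr
        exact (not_le.mp hc).le
      have h4 : √(N : ℝ) ≤ 1 / δ * |scaledMag m N k| := by
        rw [one_div, ← div_eq_inv_mul, le_div_iff₀ hδ]
        exact h3
      have h5 := mul_le_mul_of_nonneg_left (binomAtMean_le_one hk) hs.le
      linarith
  rw [weight, ← mul_assoc]
  exact mul_le_mul hbin hexp (Real.exp_pos _).le (by positivity)

theorem tendsto_magnetization_of_tendsto_scaledMag {k : ℕ → ℕ} {y : ℝ}
    (hk : Tendsto (fun N => scaledMag m N (k N)) atTop (𝓝 y)) :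
    Tendsto (fun N => magnetization N (k N)) atTop (𝓝 m) := by
  have hsq : Tendsto (fun N : ℕ => √(N : ℝ)) atTop atTop :=
    Real.tendsto_sqrt_atTop.comp tendsto_natCast_atTop_atTop
  have h1 := (hsq.inv_tendsto_atTop.mul hk).add_const m
  rw [zero_mul, zero_add] at h1
  refine h1.congr' ?_
  filter_upwards [eventually_gt_atTop 0] with N hN
  have : √(N : ℝ) ≠ 0 := by positivity
  simp only [scaledMag, Pi.inv_apply]
  field_simp
  ring

theorem tendsto_sqrt_mul_weight (hm : IsUniqueMaximizer p β h m) {k : ℕ → ℕ} {y : ℝ}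
    (hk : Tendsto (fun N => scaledMag m N (k N)) atTop (𝓝 y)) :
    Tendsto (fun N : ℕ => √(N : ℝ) * weight p β h m N (k N)) atTop
      (𝓝 (√Real.pi / (√Real.pi * √Real.pi) *
        (√(2 * ((1 + m) / 2) * (1 - (1 + m) / 2)))⁻¹ * Real.exp (H'' p β h m / 2 * y ^ 2))) := by
  have hq : Tendsto (fun N : ℕ => (k N : ℝ) / N) atTop (𝓝 ((1 + m) / 2)) := by
    refine (((tendsto_magnetization_of_tendsto_scaledMag hk).const_add 1).div_const 2).congr' ?_
    filter_upwards [eventually_gt_atTop 0] with N hN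
    unfold magnetization
    field_simp
    ring
  have h1 := tendsto_sqrt_mul_binomAtMean (by linarith [hm.1.1]) (by linarith [hm.1.2]) hq
  have h3 := (Real.continuous_exp.tendsto _).comp (tendsto_mul_H_sub hm hk)
  refine (h1.mul h3).congr fun N => ?_
  simp only [weight, Function.comp_apply]
  ring

theorem tendsto_scaledMag_floor (hm : m ∈ Set.Ioo (-1 : ℝ) 1) (y : ℝ) :
    Tendsto (fun N => scaledMag m N ⌊spinCount m N y⌋₊) atTop (𝓝 y) ∧
      ∀ᶠ N : ℕ in atTop, 0 ≤ spinCount m N y ∧ 0 < ⌊spinCount m N y⌋₊ ∧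
        ⌊spinCount m N y⌋₊ < N := by
  have hsq : Tendsto (fun N : ℕ => √(N : ℝ)) atTop atTop :=
    Real.tendsto_sqrt_atTop.comp tendsto_natCast_atTop_atTop
  have hq : Tendsto (fun N : ℕ => spinCount m N y / N) atTop (𝓝 ((1 + m) / 2)) := by
    have h1 := (hsq.inv_tendsto_atTop.mul_const (y / 2)).const_add ((1 + m) / 2)
    rw [zero_mul, add_zero] at h1
    refine h1.congr' ?_
    filter_upwards [eventually_gt_atTop 0] with N hN
    have hs : √(N : ℝ) ≠ 0 := by positivity
    have hsq : √(N : ℝ) ^ 2 = N := Real.sq_sqrt (Nat.cast_nonneg N)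
    simp only [spinCount, Pi.inv_apply]
    generalize √(N : ℝ) = s at *
    rw [← hsq]
    field_simp
  have hbig : Tendsto (fun N : ℕ => spinCount m N y) atTop atTop := by
    refine (hq.pos_mul_atTop (by linarith [hm.1]) tendsto_natCast_atTop_atTop).congr' ?_
    filter_upwards [eventually_gt_atTop 0] with N hN
    field_simp
  have hev : ∀ᶠ N : ℕ in atTop, 1 ≤ spinCount m N y ∧ spinCount m N y < N := by
    filter_upwards [hbig.eventually_ge_atTop 1,
      hq.eventually (gt_mem_nhds (by linarith [hm.2] : (1 + m) / 2 < 1)),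
      eventually_gt_atTop 0] with N h1 h2 h3
    rw [div_lt_one (by positivity)] at h2
    exact ⟨h1, h2⟩
  refine ⟨?_, ?_⟩
  · rw [tendsto_iff_dist_tendsto_zero]
    refine squeeze_zero' (Eventually.of_forall fun _ => dist_nonneg) ?_
      (hsq.const_div_atTop 2)
    filter_upwards [hev, eventually_gt_atTop 0] with N h1 h2
    exact abs_scaledMag_floor_sub_le h2 (by linarith [h1.1])
  · filter_upwards [hev] with N h1
    have h0 : 0 ≤ spinCount m N y := by linarith [h1.1]
    exact ⟨h0, Nat.floor_pos.mpr h1.1, (Nat.floor_lt h0).mpr h1.2⟩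

/-- **Laplace's method** for the sum over the number `k` of spins equal to `1`. Up to the change of
variables `spinCount`, the sum is the integral of a step function, to which dominated convergence
applies. The test functions may depend on `N`, so long as they converge along every sequence of
lattice points with a convergent scaled magnetization. -/
theorem exists_tendsto_sum_weight (hm : IsUniqueMaximizer p β h m) (h2 : H'' p β h m < 0) :
    ∃ c : ℝ, 0 < c ∧ ∀ (g : ℕ → ℕ → ℝ) (f : ℝ → ℝ) (A B : ℝ), 0 ≤ A →
      (∀ N k, k ≤ N → |g N k| ≤ A * Real.exp (B * |scaledMag m N k|)) →
      (∀ (y : ℝ) (k : ℕ → ℕ), (∀ᶠ N in atTop, 0 < k N ∧ k N < N) →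
        Tendsto (fun N => scaledMag m N (k N)) atTop (𝓝 y) →
        Tendsto (fun N => g N (k N)) atTop (𝓝 (f y))) →
      Tendsto (fun N : ℕ => ∑ k ∈ Finset.range (N + 1), weight p β h m N k * g N k) atTop
        (𝓝 (c * ∫ y, Real.exp (H'' p β h m / 2 * y ^ 2) * f y)) := by
  set c₀ : ℝ := √Real.pi / (√Real.pi * √Real.pi) *
        (√(2 * ((1 + m) / 2) * (1 - (1 + m) / 2)))⁻¹ with hc₀
  have hc₀pos : 0 < c₀ := by
    have h1 : 0 < 2 * ((1 + m) / 2) * (1 - (1 + m) / 2) :=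
      mul_pos (by linarith [hm.1.1]) (by linarith [hm.1.2])
    have := Real.sqrt_pos.mpr h1
    positivity
  refine ⟨c₀ / 2, by positivity, fun g f A B hA hbound hconv => ?_⟩
  obtain ⟨κ, C, E, hκ, hC, hE, hw⟩ := exists_sqrt_mul_weight_le hm h2
  obtain ⟨D, hD⟩ := exists_gaussian_bound hκ B hA hC hE
  set a : ℕ → ℕ → ℝ := fun N k => weight p β h m N k * g N k with ha
  set Φ : ℕ → ℝ → ℝ := fun N y => √(N : ℝ) / 2 * latticeStep (N + 1) (a N) (spinCount m N y)
    with hΦ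
  have hint : ∀ᶠ N : ℕ in atTop, ∫ y, Φ N y = ∑ k ∈ Finset.range (N + 1), a N k := by
    filter_upwards [eventually_gt_atTop 0] with N hN
    have hs : 0 < √(N : ℝ) / 2 := by positivity
    simp only [hΦ, spinCount]
    rw [integral_const_mul, Measure.integral_comp_mul_left
      (fun z => latticeStep (N + 1) (a N) (N * (1 + m) / 2 + z)) (√(N : ℝ) / 2),
      integral_add_left_eq_self, integral_latticeStep, abs_of_pos (inv_pos.mpr hs), smul_eq_mul,
      mul_inv_cancel_left₀ hs.ne']
  have hlim : Tendsto (fun N => ∫ y, Φ N y) atTop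
      (𝓝 (∫ y, c₀ / 2 * (Real.exp (H'' p β h m / 2 * y ^ 2) * f y))) := by
    refine tendsto_integral_filter_of_dominated_convergence
      (fun y => D / 2 * Real.exp (-(κ / 4) * y ^ 2)) ?_ ?_ ?_ ?_
    · refine Eventually.of_forall fun N => Measurable.aestronglyMeasurable ?_
      have h3 : Measurable (spinCount m N) := by unfold spinCount; fun_prop
      exact ((measurable_latticeStep _ _).comp h3).const_mul _
    · filter_upwards [eventually_gt_atTop 0] with N hN
      refine Eventually.of_forall fun y => ?_
      have hs1 : 1 ≤ √(N : ℝ) := by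
        rw [Real.one_le_sqrt]; exact_mod_cast hN
      have hDnn : 0 ≤ D * Real.exp (-(κ / 4) * y ^ 2) :=
        le_trans (by positivity) (hD y y (by simp))
      simp only [hΦ, latticeStep_eq]
      split_ifs with hc
      · set k := ⌊spinCount m N y⌋₊ with hk
        have hkN : k ≤ N := Nat.lt_succ_iff.mp hc.2
        have hwy : |scaledMag m N k - y| ≤ 2 :=
          (abs_scaledMag_floor_sub_le hN hc.1).trans (div_le_self (by norm_num) hs1)
        have h3 := hw N k hN hkN
        have h4 : 0 ≤ √(N : ℝ) * weight p β h m N k :=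
          mul_nonneg (by positivity) (weight_nonneg ..)
        have h5 := mul_le_mul h3 (hbound N k hkN) (abs_nonneg _)
          (h4.trans h3)
        have h6 := hD (scaledMag m N k) y hwy
        rw [Real.norm_eq_abs, ha, abs_mul, abs_mul, abs_of_nonneg (weight_nonneg ..),
          abs_of_nonneg (by positivity : 0 ≤ √(N : ℝ) / 2)]
        linarith
      · simp only [mul_zero, norm_zero]
        linarith
    · exact (integrable_exp_neg_mul_sq (by positivity)).const_mul _
    · refine Eventually.of_forall fun y => ?_
      obtain ⟨h3, h4⟩ := tendsto_scaledMag_floor hm.1 y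
      have h5 := hconv y _ (h4.mono fun N hN => hN.2) h3
      have h6 := ((tendsto_sqrt_mul_weight hm h3).mul h5).div_const 2
      have h7 : c₀ * Real.exp (H'' p β h m / 2 * y ^ 2) * f y / 2 =
        c₀ / 2 * (Real.exp (H'' p β h m / 2 * y ^ 2) * f y) := by ring
      rw [← hc₀, h7] at h6
      refine h6.congr' ?_
      filter_upwards [h4] with N hN
      simp only [hΦ, ha, latticeStep_eq]
      rw [if_pos ⟨hN.1, by omega⟩]
      ring
  rw [integral_const_mul] at hlim
  exact hlim.congr' hint

end

/-! ### Expectations under the Curie-Weiss model -/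

section

/-- The number of spins equal to `1`. -/
def upCount {N : ℕ} (X : Config N) : ℕ := (Finset.univ.filter fun i => X i = 1).card

/-- A configuration is determined by the set of its spins equal to `1`. -/
def configEquiv (N : ℕ) : Config N ≃ Finset (Fin N) where
  toFun X := Finset.univ.filter fun i => X i = 1
  invFun s i := if i ∈ s then 1 else -1
  left_inv X := by
    funext i
    rcases Int.units_eq_one_or (X i) with h | h <;> simp [h]
  right_inv s := by
    ext i
    by_cases h : i ∈ s <;> simp [h]

theorem sum_config_upCount (N : ℕ) (F : ℕ → ℝ) :
    ∑ X : Config N, F (upCount X) = ∑ k ∈ Finset.range (N + 1), (N.choose k : ℝ) * F k := by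
  have h1 : ∑ X : Config N, F (upCount X) = ∑ s : Finset (Fin N), F s.card :=
    Fintype.sum_equiv (configEquiv N) _ _ fun X => rfl
  rw [h1, ← Finset.powerset_univ, Finset.sum_powerset_apply_card]
  simp

theorem sum_spin_eq {N : ℕ} (X : Config N) : ∑ i, spin X i = 2 * (upCount X : ℝ) - N := by
  have h1 : ∀ i, spin X i = 2 * (if X i = 1 then (1 : ℝ) else 0) - 1 := by
    intro i
    rcases Int.units_eq_one_or (X i) with h | h <;> simp [spin, h]
    norm_num
  simp_rw [h1, Finset.sum_sub_distrib, ← Finset.mul_sum]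
  simp [upCount]

theorem energy_eq {N p : ℕ} (hp : 0 < p) (hN : 0 < N) (β h : ℝ) (X : Config N) :
    energy N p β h X =
      N * (β * magnetization N (upCount X) ^ p + h * magnetization N (upCount X)) := by
  have hN' : (N : ℝ) ≠ 0 := by positivity
  have h1 : ∑ I : Fin p → Fin N, ∏ k, spin X (I k) = (∑ i, spin X i) ^ p :=
    (Fintype.sum_pow (spin X) p).symm
  obtain ⟨q, rfl⟩ := Nat.exists_eq_succ_of_ne_zero hp.ne'
  rw [energy, h1, sum_spin_eq, magnetization, div_pow]
  simp only [Nat.succ_eq_add_one, Nat.add_sub_cancel]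
  rw [pow_succ (N : ℝ) q]
  field_simp

variable {p : ℕ} {β h m : ℝ}

theorem sum_exp_energy_mul (hp : 0 < p) {N : ℕ} (hN : 0 < N) (g : ℕ → ℝ) :
    ∑ X : Config N, Real.exp (energy N p β h X) * g (upCount X) =
      2 ^ N * Real.exp (N * H p β h m) *
        ∑ k ∈ Finset.range (N + 1), weight p β h m N k * g k := by
  simp_rw [energy_eq hp hN]
  rw [sum_config_upCount N fun k => Real.exp (N * (β * magnetization N k ^ p +
    h * magnetization N k)) * g k, Finset.mul_sum]
  refine Finset.sum_congr rfl fun k hk => ?_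
  rw [choose_eq_binomAtMean_mul_exp hN (Nat.lt_succ_iff.mp (Finset.mem_range.mp hk)), weight]
  have h1 : Real.exp (-(N * binEntropy (magnetization N k))) *
      Real.exp (N * (β * magnetization N k ^ p + h * magnetization N k)) =
      Real.exp (N * H p β h m) *
        Real.exp (N * (H p β h (magnetization N k) - H p β h m)) := by
    rw [← Real.exp_add, ← Real.exp_add]
    congr 1
    simp only [H]
    ring
  linear_combination 2 ^ N * binomAtMean N k * g k * h1

theorem integral_model (N p : ℕ) (β h : ℝ) (F : Config N → ℝ) :
    ∫ X, F X ∂(model N p β h) = ∑ X, likelihood N p β h X * F X := by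
  rw [model, integral_finsetSum_measure fun X _ =>
    (Integrable.of_finite (μ := Measure.dirac X)).smul_measure ENNReal.ofReal_ne_top]
  refine Finset.sum_congr rfl fun X _ => ?_
  rw [integral_smul_measure, integral_dirac, ENNReal.toReal_ofReal (likelihood_nonneg ..),
    smul_eq_mul]

theorem two_pow_mul_partitionFn (N p : ℕ) (β h : ℝ) :
    2 ^ N * partitionFn N p β h = ∑ X : Config N, Real.exp (energy N p β h X) := by
  unfold partitionFn
  field_simp

theorem integral_model_eq_div (N p : ℕ) (β h : ℝ) (F : Config N → ℝ) :
    ∫ X, F X ∂(model N p β h) =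
      (∑ X, Real.exp (energy N p β h X) * F X) / ∑ X : Config N, Real.exp (energy N p β h X) := by
  rw [integral_model, Finset.sum_div]
  refine Finset.sum_congr rfl fun X _ => ?_
  rw [likelihood, two_pow_mul_partitionFn]
  ring

theorem integral_model_upCount (hp : 0 < p) {N : ℕ} (hN : 0 < N) (g : ℕ → ℝ) :
    ∫ X, g (upCount X) ∂(model N p β h) =
      (∑ k ∈ Finset.range (N + 1), weight p β h m N k * g k) /
        ∑ k ∈ Finset.range (N + 1), weight p β h m N k * 1 := by
  rw [integral_model_eq_div, sum_exp_energy_mul (m := m) hp hN]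
  have h1 := sum_exp_energy_mul (p := p) (β := β) (h := h) (m := m) hp hN fun _ => 1
  simp only [mul_one] at h1 ⊢
  rw [h1, mul_div_mul_left _ _ (by positivity)]

/-- The limiting variance `-1 / H''(m)` of the scaled magnetization. -/
noncomputable def limitVar (p : ℕ) (β h m : ℝ) : NNReal := (Real.toNNReal (-H'' p β h m))⁻¹

theorem coe_limitVar (h2 : H'' p β h m < 0) : (limitVar p β h m : ℝ) = (-H'' p β h m)⁻¹ := by
  rw [limitVar, NNReal.coe_inv, Real.coe_toNNReal _ (by linarith)]

theorem limitVar_ne_zero (h2 : H'' p β h m < 0) : limitVar p β h m ≠ 0 := by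
  have : (limitVar p β h m : ℝ) ≠ 0 := by
    rw [coe_limitVar h2]
    exact inv_ne_zero (by linarith)
  exact_mod_cast this

theorem integral_gaussian_limitVar (h2 : H'' p β h m < 0) (f : ℝ → ℝ) :
    ∫ y, f y ∂(gaussianReal 0 (limitVar p β h m)) =
      (√(2 * Real.pi * limitVar p β h m))⁻¹ *
        ∫ y, Real.exp (H'' p β h m / 2 * y ^ 2) * f y := by
  rw [integral_gaussianReal_eq_integral_smul (limitVar_ne_zero h2), ← integral_const_mul]
  refine integral_congr_ae (Eventually.of_forall fun y => ?_)
  have h3 : -(y - 0) ^ 2 / (2 * (limitVar p β h m : ℝ)) = H'' p β h m / 2 * y ^ 2 := by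
    rw [coe_limitVar h2]
    have : H'' p β h m ≠ 0 := h2.ne
    field_simp
    ring
  simp only [gaussianPDFReal, h3, smul_eq_mul]
  ring

/-- **Central limit theorem** for the scaled magnetization, for test functions of exponential
growth that may vary with `N`. -/
theorem tendsto_integral_upCount (hp : 0 < p) (hm : IsUniqueMaximizer p β h m)
    (h2 : H'' p β h m < 0) (g : ℕ → ℕ → ℝ) (f : ℝ → ℝ) (A B : ℝ) (hA : 0 ≤ A)
    (hbound : ∀ N k, k ≤ N → |g N k| ≤ A * Real.exp (B * |scaledMag m N k|))
    (hconv : ∀ (y : ℝ) (k : ℕ → ℕ), (∀ᶠ N in atTop, 0 < k N ∧ k N < N) →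
        Tendsto (fun N => scaledMag m N (k N)) atTop (𝓝 y) →
        Tendsto (fun N => g N (k N)) atTop (𝓝 (f y))) :
    Tendsto (fun N : ℕ => ∫ X, g N (upCount X) ∂(model N p β h)) atTop
      (𝓝 (∫ y, f y ∂(gaussianReal 0 (limitVar p β h m)))) := by
  obtain ⟨c, hc, hT⟩ := exists_tendsto_sum_weight hm h2
  have h1 := hT g f A B hA hbound hconv
  have h3 := hT (fun _ _ => 1) (fun _ => 1) 1 0 zero_le_one (by simp)
    (fun _ _ _ _ => tendsto_const_nhds)
  have hone := integral_gaussian_limitVar h2 fun _ => (1 : ℝ)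
  simp only [integral_const, probReal_univ, smul_eq_mul, mul_one] at hone h3
  have hI : ∫ y, Real.exp (H'' p β h m / 2 * y ^ 2) ≠ 0 := by
    intro h0
    rw [h0, mul_zero] at hone
    exact one_ne_zero hone
  have h4 := h1.div h3 (mul_ne_zero hc.ne' hI)
  have h5 : c * (∫ y, Real.exp (H'' p β h m / 2 * y ^ 2) * f y) /
      (c * ∫ y, Real.exp (H'' p β h m / 2 * y ^ 2)) =
      ∫ y, f y ∂(gaussianReal 0 (limitVar p β h m)) := by
    rw [integral_gaussian_limitVar h2, mul_div_mul_left _ _ hc.ne', div_eq_mul_inv, mul_comm]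
    congr 1
    exact inv_eq_of_mul_eq_one_left hone.symm
  rw [h5] at h4
  refine h4.congr' ?_
  filter_upwards [eventually_gt_atTop 0] with N hN
  rw [integral_model_upCount (m := m) hp hN]
  simp

end

/-! ### The likelihood as a function of the field -/

section

/-- The inverse likelihood of `X` at the field `t`: a sum of exponentials in `t`, hence convex. -/
noncomputable def invLikelihood (N p : ℕ) (β : ℝ) (X : Config N) (t : ℝ) : ℝ :=
  ∑ Y : Config N, Real.exp (energy N p β t Y - energy N p β t X)

/-- The derivative of `invLikelihood` with respect to the field. -/
noncomputable def invLikelihoodDeriv (N p : ℕ) (β : ℝ) (X : Config N) (t : ℝ) : ℝ :=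
  ∑ Y : Config N, (∑ i, spin Y i - ∑ i, spin X i) *
    Real.exp (energy N p β t Y - energy N p β t X)

variable {N p : ℕ} {β : ℝ}

theorem energy_add (t s : ℝ) (X : Config N) :
    energy N p β (t + s) X = energy N p β t X + s * ∑ i, spin X i := by
  unfold energy; ring

theorem invLikelihood_pos (X : Config N) (t : ℝ) : 0 < invLikelihood N p β X t :=
  Finset.sum_pos (fun _ _ => Real.exp_pos _) Finset.univ_nonempty

theorem likelihood_eq_inv (X : Config N) (t : ℝ) :
    likelihood N p β t X = (invLikelihood N p β X t)⁻¹ := by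
  rw [likelihood, two_pow_mul_partitionFn, invLikelihood]
  simp_rw [Real.exp_sub, ← Finset.sum_div]
  rw [inv_div]

theorem isLikelihoodMaximizer_iff {X : Config N} {h' : ℝ} :
    IsLikelihoodMaximizer N p β X h' ↔
      ∀ t, invLikelihood N p β X h' ≤ invLikelihood N p β X t := by
  unfold IsLikelihoodMaximizer
  simp_rw [likelihood_eq_inv, inv_le_inv₀ (invLikelihood_pos X _) (invLikelihood_pos X _)]

theorem hasDerivAt_invLikelihood (X : Config N) (t : ℝ) :
    HasDerivAt (invLikelihood N p β X) (invLikelihoodDeriv N p β X t) t := by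
  unfold invLikelihoodDeriv
  refine HasDerivAt.fun_sum fun Y _ => ?_
  have h1 : ∀ Z : Config N, HasDerivAt (fun t => energy N p β t Z) (∑ i, spin Z i) t := by
    intro Z
    unfold energy
    exact HasDerivAt.const_add _ (by simpa using (hasDerivAt_id t).mul_const (∑ i, spin Z i))
  rw [mul_comm]
  exact ((h1 Y).sub (h1 X)).exp

theorem energy_sub_energy (X Y : Config N) (t : ℝ) :
    energy N p β t Y - energy N p β t X =
      energy N p β 0 Y - energy N p β 0 X + t * (∑ i, spin Y i - ∑ i, spin X i) := by
  unfold energy; ring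

theorem strictMono_invLikelihoodDeriv {X Y : Config N}
    (hY : ∑ i, spin Y i ≠ ∑ i, spin X i) : StrictMono (invLikelihoodDeriv N p β X) := by
  intro s t hst
  unfold invLikelihoodDeriv
  simp_rw [energy_sub_energy X _ s, energy_sub_energy X _ t, Real.exp_add, ← mul_assoc,
    mul_comm _ (Real.exp (energy N p β 0 _ - _)), mul_assoc]
  refine Finset.sum_lt_sum (fun Z _ => ?_) ⟨Y, Finset.mem_univ _, ?_⟩
  · refine mul_le_mul_of_nonneg_left ?_ (Real.exp_pos _).le
    rcases le_total 0 (∑ i, spin Z i - ∑ i, spin X i) with h | h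
    · exact mul_le_mul_of_nonneg_left (Real.exp_le_exp.mpr (by nlinarith)) h
    · exact mul_le_mul_of_nonpos_left (Real.exp_le_exp.mpr (by nlinarith)) h
  · refine mul_lt_mul_of_pos_left ?_ (Real.exp_pos _)
    rcases lt_or_gt_of_ne (sub_ne_zero.mpr hY) with h | h
    · exact mul_lt_mul_of_neg_left (Real.exp_lt_exp.mpr (by nlinarith)) h
    · exact mul_lt_mul_of_pos_left (Real.exp_lt_exp.mpr (by nlinarith)) h

theorem IsLikelihoodMaximizer.invLikelihoodDeriv_eq_zero {X : Config N} {h' : ℝ}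
    (hX : IsLikelihoodMaximizer N p β X h') : invLikelihoodDeriv N p β X h' = 0 := by
  have hmin : IsLocalMin (invLikelihood N p β X) h' :=
    Eventually.of_forall (isLikelihoodMaximizer_iff.mp hX)
  rw [← (hasDerivAt_invLikelihood X h').deriv]
  exact hmin.deriv_eq_zero

theorem upCount_const_neg_one (N : ℕ) : upCount (fun _ : Fin N => (-1 : ℤˣ)) = 0 := by
  simp [upCount]

theorem upCount_const_one (N : ℕ) : upCount (fun _ : Fin N => (1 : ℤˣ)) = N := by
  simp [upCount]

/-- If the spins of `X` do not all agree, some configurations have a larger and some a smaller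
total spin, which makes the inverse likelihood coercive. -/
theorem exists_isLikelihoodMaximizer {X : Config N} (h0 : 0 < upCount X) (h1 : upCount X < N) :
    ∃ h' : ℝ, IsLikelihoodMaximizer N p β X h' := by
  have h0' : (0 : ℝ) < upCount X := by exact_mod_cast h0
  have h1' : (upCount X : ℝ) < N := by exact_mod_cast h1
  have hterm : ∀ (Y : Config N) (t : ℝ), Real.exp (energy N p β 0 Y - energy N p β 0 X +
      (2 * (upCount Y : ℝ) - 2 * upCount X) * t) ≤ invLikelihood N p β X t := by
    intro Y t
    have h2 : energy N p β 0 Y - energy N p β 0 X + (2 * (upCount Y : ℝ) - 2 * upCount X) * t =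
        energy N p β t Y - energy N p β t X := by
      rw [energy_sub_energy X Y t, sum_spin_eq, sum_spin_eq]; ring
    rw [h2]
    exact Finset.single_le_sum (f := fun Y => Real.exp (energy N p β t Y - energy N p β t X))
      (fun _ _ => (Real.exp_pos _).le) (Finset.mem_univ Y)
  have hcont : Continuous (invLikelihood N p β X) :=
    continuous_iff_continuousAt.mpr fun t => (hasDerivAt_invLikelihood X t).continuousAt
  obtain ⟨h', hh'⟩ := hcont.exists_forall_le (β := ℝ) (by
    rw [cocompact_eq_atBot_atTop, tendsto_sup]
    constructor
    · refine tendsto_atTop_mono (hterm fun _ => -1) (Real.tendsto_exp_atTop.comp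
        (tendsto_atTop_add_const_left _ _ ?_))
      rw [upCount_const_neg_one]
      exact tendsto_id.const_mul_atBot_of_neg (by push_cast; linarith)
    · refine tendsto_atTop_mono (hterm fun _ => 1) (Real.tendsto_exp_atTop.comp
        (tendsto_atTop_add_const_left _ _ ?_))
      rw [upCount_const_one]
      exact tendsto_id.const_mul_atTop (by linarith))
  exact ⟨h', isLikelihoodMaximizer_iff.mpr hh'⟩

theorem strictMono_invLikelihoodDeriv_of_upCount_pos {X : Config N} (h0 : 0 < upCount X) :
    StrictMono (invLikelihoodDeriv N p β X) := by
  refine strictMono_invLikelihoodDeriv (Y := fun _ => -1) ?_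
  rw [sum_spin_eq, sum_spin_eq, upCount_const_neg_one]
  have h0' : (0 : ℝ) < upCount X := by exact_mod_cast h0
  push_cast
  intro h
  linarith

theorem IsLikelihoodMaximizer.unique {X : Config N} (h0 : 0 < upCount X) {s t : ℝ}
    (hs : IsLikelihoodMaximizer N p β X s) (ht : IsLikelihoodMaximizer N p β X t) : s = t :=
  (strictMono_invLikelihoodDeriv_of_upCount_pos h0).injective
    (hs.invLikelihoodDeriv_eq_zero.trans ht.invLikelihoodDeriv_eq_zero.symm)

theorem energy_congr (hp : 0 < p) (hN : 0 < N) {X Y : Config N} (hXY : upCount X = upCount Y)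
    (t : ℝ) : energy N p β t X = energy N p β t Y := by
  rw [energy_eq hp hN, energy_eq hp hN, hXY]

theorem isLikelihoodMaximizer_congr (hp : 0 < p) (hN : 0 < N) {X Y : Config N}
    (hXY : upCount X = upCount Y) (t : ℝ) :
    IsLikelihoodMaximizer N p β X t ↔ IsLikelihoodMaximizer N p β Y t := by
  simp only [IsLikelihoodMaximizer, likelihood, energy_congr hp hN hXY]

theorem sum_spin_eq_scaledMag (hN : 0 < N) (m : ℝ) (X : Config N) :
    ∑ i, spin X i = √(N : ℝ) * scaledMag m N (upCount X) + N * m := by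
  have hsq : √(N : ℝ) * √(N : ℝ) = N := Real.mul_self_sqrt (Nat.cast_nonneg N)
  have hN' : (N : ℝ) ≠ 0 := by positivity
  rw [sum_spin_eq, scaledMag, ← mul_assoc, hsq, magnetization]
  field_simp
  ring

/-- Moving the field by `x / √N` tilts the law of the scaled magnetization by `exp (x ·)`. -/
theorem invLikelihoodDeriv_eq (hN : 0 < N) (h m x : ℝ) (X : Config N) :
    ∃ C : ℝ, 0 < C ∧ invLikelihoodDeriv N p β X (h + x / √(N : ℝ)) =
      C * (∫ Y, scaledMag m N (upCount Y) * Real.exp (x * scaledMag m N (upCount Y))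
          ∂(model N p β h) -
        scaledMag m N (upCount X) *
          ∫ Y, Real.exp (x * scaledMag m N (upCount Y)) ∂(model N p β h)) := by
  have hs : 0 < √(N : ℝ) := by positivity
  have hZ : 0 < ∑ X : Config N, Real.exp (energy N p β h X) :=
    Finset.sum_pos (fun _ _ => Real.exp_pos _) Finset.univ_nonempty
  set Z := ∑ X : Config N, Real.exp (energy N p β h X) with hZdef
  refine ⟨√(N : ℝ) * Real.exp (x / √(N : ℝ) * (N * m) - energy N p β (h + x / √(N : ℝ)) X) * Z,
    by positivity, ?_⟩
  rw [integral_model_eq_div, integral_model_eq_div, ← hZdef, mul_div_assoc', ← sub_div,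
    mul_assoc _ Z, mul_div_cancel₀ _ hZ.ne', Finset.mul_sum, ← Finset.sum_sub_distrib,
    Finset.mul_sum, invLikelihoodDeriv]
  refine Finset.sum_congr rfl fun Y _ => ?_
  have h1 : energy N p β (h + x / √(N : ℝ)) Y - energy N p β (h + x / √(N : ℝ)) X =
      (x / √(N : ℝ) * (N * m) - energy N p β (h + x / √(N : ℝ)) X) + energy N p β h Y +
        x * scaledMag m N (upCount Y) := by
    rw [energy_add h _ Y, sum_spin_eq_scaledMag hN m Y]
    field_simp
    ring
  rw [h1, Real.exp_add, Real.exp_add, sum_spin_eq_scaledMag hN m Y, sum_spin_eq_scaledMag hN m X]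
  ring

theorem deriv_log_likelihood (hN : 0 < N) (h m : ℝ) (X : Config N) :
    deriv (fun t : ℝ => Real.log (likelihood N p β t X)) h =
      √(N : ℝ) * (scaledMag m N (upCount X) -
        ∫ Y, scaledMag m N (upCount Y) ∂(model N p β h)) := by
  have hd := ((hasDerivAt_invLikelihood (p := p) (β := β) X h).log
    (invLikelihood_pos X h).ne').neg
  have he : (fun t : ℝ => Real.log (likelihood N p β t X)) =
      -fun t => Real.log (invLikelihood N p β X t) := by
    funext t
    rw [likelihood_eq_inv, Real.log_inv]
    rfl
  have hZ : 0 < ∑ X : Config N, Real.exp (energy N p β h X) :=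
    Finset.sum_pos (fun _ _ => Real.exp_pos _) Finset.univ_nonempty
  rw [he, hd.deriv, integral_model_eq_div, invLikelihoodDeriv, invLikelihood]
  simp_rw [Real.exp_sub, sum_spin_eq_scaledMag hN m, ← Finset.sum_div]
  have h1 : ∑ Y : Config N, (√(N : ℝ) * scaledMag m N (upCount Y) + N * m -
      (√(N : ℝ) * scaledMag m N (upCount X) + N * m)) *
        (Real.exp (energy N p β h Y) / Real.exp (energy N p β h X)) =
      √(N : ℝ) * (∑ Y : Config N, Real.exp (energy N p β h Y) * scaledMag m N (upCount Y) -
        scaledMag m N (upCount X) * ∑ Y : Config N, Real.exp (energy N p β h Y)) /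
          Real.exp (energy N p β h X) := by
    rw [Finset.mul_sum, ← Finset.sum_sub_distrib, Finset.mul_sum, Finset.sum_div]
    exact Finset.sum_congr rfl fun Y _ => by ring
  rw [h1]
  have := Real.exp_pos (energy N p β h X)
  field_simp
  ring

end

/-! ### Limits of the moments and of the likelihood equation -/

section

variable {p : ℕ} {β h m : ℝ}

theorem abs_le_exp_abs (w : ℝ) : |w| ≤ Real.exp |w| := by
  linarith [Real.add_one_le_exp |w|]

theorem tendsto_integral_exp_scaledMag (hp : 0 < p) (hm : IsUniqueMaximizer p β h m)
    (h2 : H'' p β h m < 0) (x : ℝ) :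
    Tendsto (fun N : ℕ => ∫ X, Real.exp (x * scaledMag m N (upCount X)) ∂(model N p β h)) atTop
      (𝓝 (Real.exp (limitVar p β h m * x ^ 2 / 2))) := by
  have h3 := tendsto_integral_upCount hp hm h2 (fun N k => Real.exp (x * scaledMag m N k))
    (fun y => Real.exp (x * y)) 1 |x| zero_le_one
    (fun N k _ => by
      rw [Real.abs_exp, one_mul, ← abs_mul]
      exact Real.exp_le_exp.mpr (le_abs_self _))
    (fun y k _ hk => (Real.continuous_exp.tendsto _).comp (hk.const_mul x))
  have h4 : ∫ y, Real.exp (x * y) ∂(gaussianReal 0 (limitVar p β h m)) =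
      mgf (fun y => y) (gaussianReal 0 (limitVar p β h m)) x := rfl
  rw [h4, mgf_fun_id_gaussianReal] at h3
  simpa using h3

theorem integral_mul_exp_gaussianReal (v : NNReal) (x : ℝ) :
    ∫ y, y * Real.exp (x * y) ∂(gaussianReal 0 v) = v * x * Real.exp (v * x ^ 2 / 2) := by
  have h1 : deriv (mgf (fun y => y) (gaussianReal 0 v)) x =
      ∫ y, y * Real.exp (x * y) ∂(gaussianReal 0 v) := deriv_mgf (by simp)
  rw [← h1, mgf_fun_id_gaussianReal]
  have h3 : HasDerivAt (fun t : ℝ => Real.exp (0 * t + v * t ^ 2 / 2))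
      (Real.exp (0 * x + v * x ^ 2 / 2) * (v * x)) x := by
    refine HasDerivAt.exp ?_
    have h4 := (((hasDerivAt_id x).const_mul 0).add
      ((((hasDerivAt_id x).pow 2).const_mul (v : ℝ)).div_const 2))
    refine h4.congr_deriv ?_
    simp
    ring
  rw [h3.deriv, zero_mul, zero_add]
  ring

theorem tendsto_integral_mul_exp_scaledMag (hp : 0 < p) (hm : IsUniqueMaximizer p β h m)
    (h2 : H'' p β h m < 0) (x : ℝ) :
    Tendsto (fun N : ℕ => ∫ X, scaledMag m N (upCount X) *
        Real.exp (x * scaledMag m N (upCount X)) ∂(model N p β h)) atTop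
      (𝓝 (limitVar p β h m * x * Real.exp (limitVar p β h m * x ^ 2 / 2))) := by
  rw [← integral_mul_exp_gaussianReal]
  refine tendsto_integral_upCount hp hm h2 (fun N k => scaledMag m N k *
    Real.exp (x * scaledMag m N k)) (fun y => y * Real.exp (x * y)) 1 (1 + |x|) zero_le_one
    (fun N k _ => ?_)
    (fun y k _ hk => hk.mul ((Real.continuous_exp.tendsto _).comp (hk.const_mul x)))
  rw [abs_mul, Real.abs_exp, one_mul, add_mul, one_mul, Real.exp_add, ← abs_mul]
  exact mul_le_mul (abs_le_exp_abs _) (Real.exp_le_exp.mpr (le_abs_self _)) (Real.exp_pos _).le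
    (Real.exp_pos _).le

theorem tendsto_integral_scaledMag (hp : 0 < p) (hm : IsUniqueMaximizer p β h m)
    (h2 : H'' p β h m < 0) :
    Tendsto (fun N : ℕ => ∫ X, scaledMag m N (upCount X) ∂(model N p β h)) atTop (𝓝 0) := by
  simpa using tendsto_integral_mul_exp_scaledMag hp hm h2 0

theorem tendsto_integral_scaledMag_sq (hp : 0 < p) (hm : IsUniqueMaximizer p β h m)
    (h2 : H'' p β h m < 0) :
    Tendsto (fun N : ℕ => ∫ X, scaledMag m N (upCount X) ^ 2 ∂(model N p β h)) atTop
      (𝓝 (limitVar p β h m)) := by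
  have h3 : ∫ y, y ^ 2 ∂(gaussianReal 0 (limitVar p β h m)) = limitVar p β h m := by
    have h4 := variance_fun_id_gaussianReal (μ := 0) (v := limitVar p β h m)
    rw [variance_eq_integral (by fun_prop)] at h4
    simpa using h4
  rw [← h3]
  refine tendsto_integral_upCount hp hm h2 (fun N k => scaledMag m N k ^ 2) (fun y => y ^ 2)
    1 2 zero_le_one (fun N k _ => ?_) (fun y k _ hk => hk.pow 2)
  rw [abs_pow, one_mul, two_mul, Real.exp_add, ← sq]
  exact pow_le_pow_left₀ (abs_nonneg _) (abs_le_exp_abs _) 2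

theorem fisherInfo_eq {N : ℕ} (hN : 0 < N) (p : ℕ) (β h m : ℝ) :
    fisherInfo N p β h = ∫ X, scaledMag m N (upCount X) ^ 2 ∂(model N p β h) -
      (∫ X, scaledMag m N (upCount X) ∂(model N p β h)) ^ 2 := by
  have hN' : (N : ℝ) ≠ 0 := by positivity
  have h1 := variance_eq_integral (μ := model N p β h)
    (X := fun X => scaledMag m N (upCount X)) (measurable_of_finite _).aemeasurable
  have h3 := variance_eq_sub (μ := model N p β h)
    (X := fun X => scaledMag m N (upCount X)) MemLp.of_discrete
  rw [h1] at h3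
  simp only [Pi.pow_apply] at h3
  rw [← h3, fisherInfo]
  simp_rw [deriv_log_likelihood hN h m, mul_pow, Real.sq_sqrt (Nat.cast_nonneg N)]
  rw [integral_const_mul]
  field_simp

theorem tendsto_inv_fisherInfo (hp : 0 < p) (hm : IsUniqueMaximizer p β h m)
    (h2 : H'' p β h m < 0) :
    Tendsto (fun N : ℕ => (fisherInfo N p β h)⁻¹) atTop (𝓝 (-H'' p β h m)) := by
  have h3 := (tendsto_integral_scaledMag_sq hp hm h2).sub
    ((tendsto_integral_scaledMag hp hm h2).pow 2)
  have h4 : ((limitVar p β h m : ℝ) - 0 ^ 2) = (-H'' p β h m)⁻¹ := by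
    rw [coe_limitVar h2]; simp
  rw [h4] at h3
  have h5 := h3.inv₀ (inv_ne_zero (by linarith))
  rw [inv_inv] at h5
  refine h5.congr' ?_
  filter_upwards [eventually_gt_atTop 0] with N hN
  rw [fisherInfo_eq hN p β h m]

/-- Along configurations with convergent scaled magnetization the error of the maximum likelihood
estimate, scaled by `√N`, converges. The estimate exceeds `h + x / √N` exactly if the derivative
of the inverse likelihood is negative there, and the limit of that derivative has the sign of
`limitVar * x - w`. -/
theorem tendsto_sqrt_mul_maximizer_sub (hp : 0 < p) (hm : IsUniqueMaximizer p β h m)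
    (h2 : H'' p β h m < 0) {X : (N : ℕ) → Config N} {t : ℕ → ℝ} {w : ℝ}
    (h0 : ∀ᶠ N in atTop, 0 < upCount (X N))
    (ht : ∀ᶠ N in atTop, IsLikelihoodMaximizer N p β (X N) (t N))
    (hw : Tendsto (fun N => scaledMag m N (upCount (X N))) atTop (𝓝 w)) :
    Tendsto (fun N : ℕ => √(N : ℝ) * (t N - h)) atTop (𝓝 (-H'' p β h m * w)) := by
  set v := limitVar p β h m with hv
  have hv' : (v : ℝ) = (-H'' p β h m)⁻¹ := coe_limitVar h2
  have hpos : 0 < -H'' p β h m := by linarith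
  have hlim : ∀ x : ℝ, Tendsto (fun N : ℕ =>
      ∫ Y, scaledMag m N (upCount Y) * Real.exp (x * scaledMag m N (upCount Y)) ∂(model N p β h) -
        scaledMag m N (upCount (X N)) *
          ∫ Y, Real.exp (x * scaledMag m N (upCount Y)) ∂(model N p β h)) atTop
      (𝓝 (Real.exp (v * x ^ 2 / 2) * (v * x - w))) := by
    intro x
    have h5 := (tendsto_integral_mul_exp_scaledMag hp hm h2 x).sub
      (hw.mul (tendsto_integral_exp_scaledMag hp hm h2 x))
    have h6 : (v : ℝ) * x * Real.exp (v * x ^ 2 / 2) - w * Real.exp (v * x ^ 2 / 2) =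
      Real.exp (v * x ^ 2 / 2) * (v * x - w) := by ring
    rwa [← hv, h6] at h5
  refine tendsto_order.mpr ⟨fun x hx => ?_, fun x hx => ?_⟩
  · have hneg : (v : ℝ) * x - w < 0 := by
      rw [hv', inv_mul_eq_div, sub_neg, div_lt_iff₀ hpos]
      linarith
    filter_upwards [(hlim x).eventually (gt_mem_nhds
      (mul_neg_of_pos_of_neg (Real.exp_pos _) hneg)), h0, ht, eventually_gt_atTop 0]
      with N h3 h4 h5 hN
    have hs : 0 < √(N : ℝ) := by positivity
    obtain ⟨C, hC, hD⟩ := invLikelihoodDeriv_eq (p := p) (β := β) hN h m x (X N)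
    have h6 : invLikelihoodDeriv N p β (X N) (h + x / √(N : ℝ)) <
        invLikelihoodDeriv N p β (X N) (t N) := by
      rw [h5.invLikelihoodDeriv_eq_zero, hD]
      exact mul_neg_of_pos_of_neg hC h3
    have h7 := (strictMono_invLikelihoodDeriv_of_upCount_pos h4).lt_iff_lt.mp h6
    rw [← div_lt_iff₀' hs]
    linarith
  · have hgt : 0 < (v : ℝ) * x - w := by
      rw [hv', inv_mul_eq_div, sub_pos, lt_div_iff₀ hpos]
      linarith
    filter_upwards [(hlim x).eventually (lt_mem_nhds (mul_pos (Real.exp_pos _) hgt)), h0, ht,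
      eventually_gt_atTop 0] with N h3 h4 h5 hN
    have hs : 0 < √(N : ℝ) := by positivity
    obtain ⟨C, hC, hD⟩ := invLikelihoodDeriv_eq (p := p) (β := β) hN h m x (X N)
    have h6 : invLikelihoodDeriv N p β (X N) (t N) <
        invLikelihoodDeriv N p β (X N) (h + x / √(N : ℝ)) := by
      rw [h5.invLikelihoodDeriv_eq_zero, hD]
      exact mul_pos hC h3
    have h7 := (strictMono_invLikelihoodDeriv_of_upCount_pos h4).lt_iff_lt.mp h6
    rw [← lt_div_iff₀' hs]
    linarith

/-! ### The limit law of the maximum likelihood estimate -/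

/-- The indicator of the two extreme counts `0` and `N`, at which all spins agree. -/
noncomputable def extremeIndicator (N k : ℕ) : ℝ := if 0 < k ∧ k < N then 0 else 1

theorem tendsto_integral_extremeIndicator (hp : 0 < p) (hm : IsUniqueMaximizer p β h m)
    (h2 : H'' p β h m < 0) :
    Tendsto (fun N : ℕ => ∫ X, extremeIndicator N (upCount X) ∂(model N p β h)) atTop (𝓝 0) := by
  have h3 := tendsto_integral_upCount hp hm h2 extremeIndicator (fun _ => 0) 1 0 zero_le_one
    (fun N k _ => by unfold extremeIndicator; split_ifs <;> simp)
    (fun y k hk _ => tendsto_const_nhds.congr' (by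
      filter_upwards [hk] with N hN
      simp [extremeIndicator, hN]))
  simpa using h3

/-- A configuration of `N` spins, the first `k` of which are `1`. -/
def stepConfig (N k : ℕ) : Config N := fun i => if (i : ℕ) < k then 1 else -1

theorem upCount_stepConfig {N k : ℕ} (hk : k ≤ N) : upCount (stepConfig N k) = k := by
  unfold upCount
  have h1 : (Finset.univ.filter fun i : Fin N => stepConfig N k i = 1) =
      Finset.univ.filter fun i : Fin N => (i : ℕ) < k := by
    ext i
    by_cases h : (i : ℕ) < k <;> simp [stepConfig, h]
  rw [h1, Fin.card_filter_val_lt, min_eq_right hk]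

theorem existsUnique_isLikelihoodMaximizer {N : ℕ} {X : Config N} (h0 : 0 < upCount X)
    (h1 : upCount X < N) : ∃! h' : ℝ, IsLikelihoodMaximizer N p β X h' := by
  obtain ⟨t, ht⟩ := exists_isLikelihoodMaximizer (p := p) (β := β) h0 h1
  exact ⟨t, ht, fun s hs => hs.unique h0 ht⟩

/-- A unique maximizer exists unless all spins agree, an event of vanishing probability. -/
theorem tendsto_model_existsUnique (hp : 0 < p) (hm : IsUniqueMaximizer p β h m)
    (h2 : H'' p β h m < 0) :
    Tendsto (fun N : ℕ => model N p β h
        {X | ∃! h' : ℝ, IsLikelihoodMaximizer N p β X h'}) atTop (𝓝 1) := by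
  rw [← ENNReal.tendsto_toReal_iff (fun _ => measure_ne_top _ _) ENNReal.one_ne_top,
    ENNReal.toReal_one]
  have h3 := (tendsto_integral_extremeIndicator hp hm h2).const_sub 1
  rw [sub_zero] at h3
  refine tendsto_of_tendsto_of_tendsto_of_le_of_le h3 tendsto_const_nhds (fun N => ?_)
    (fun N => measureReal_le_one (μ := model N p β h))
  change _ ≤ (model N p β h).real _
  rw [← integral_indicator_one (MeasurableSet.of_discrete)]
  have h4 : 1 - ∫ X, extremeIndicator N (upCount X) ∂(model N p β h) =
      ∫ X, (1 - extremeIndicator N (upCount X)) ∂(model N p β h) := by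
    rw [integral_sub Integrable.of_finite Integrable.of_finite]
    simp
  rw [h4]
  refine integral_mono Integrable.of_finite Integrable.of_finite fun X => ?_
  by_cases hX : 0 < upCount X ∧ upCount X < N
  · have h5 : X ∈ {X | ∃! h' : ℝ, IsLikelihoodMaximizer N p β X h'} :=
      existsUnique_isLikelihoodMaximizer hX.1 hX.2
    rw [Set.indicator_of_mem h5]
    simp [extremeIndicator, hX]
  · simp only [extremeIndicator, if_neg hX, sub_self]
    exact Set.indicator_nonneg (fun _ _ => zero_le_one) X

/-- Weak convergence of the scaled error of the maximum likelihood estimate. The limit law appears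
as the image of the limit law of the scaled magnetization under multiplication by `-H''(m)`. -/
theorem tendsto_integral_comp_mle (hp : 0 < p) (hm : IsUniqueMaximizer p β h m)
    (h2 : H'' p β h m < 0) {hHat : (N : ℕ) → Config N → ℝ} (hMLE : ∀ N, IsMLE N p β (hHat N))
    {φ : ℝ → ℝ} (hφ : Continuous φ) {K : ℝ} (hK : ∀ x, |φ x| ≤ K) :
    Tendsto (fun N : ℕ => ∫ X, φ (√(N : ℝ) * (hHat N X - h)) ∂(model N p β h)) atTop
      (𝓝 (∫ y, φ (-H'' p β h m * y) ∂(gaussianReal 0 (limitVar p β h m)))) := by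
  have hK0 : 0 ≤ K := (abs_nonneg _).trans (hK 0)
  have hmax : ∀ (N : ℕ) (X : Config N), 0 < upCount X → upCount X < N →
      IsLikelihoodMaximizer N p β X (hHat N X) := fun N X h3 h4 =>
    hMLE N X (exists_isLikelihoodMaximizer h3 h4)
  -- Unless all spins agree, the estimate depends on the number of spins `1` only.
  set g : ℕ → ℕ → ℝ := fun N k => φ (√(N : ℝ) * (hHat N (stepConfig N k) - h)) with hg
  have h3 : Tendsto (fun N : ℕ => ∫ X, g N (upCount X) ∂(model N p β h)) atTop
      (𝓝 (∫ y, φ (-H'' p β h m * y) ∂(gaussianReal 0 (limitVar p β h m)))) := by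
    refine tendsto_integral_upCount hp hm h2 g (fun y => φ (-H'' p β h m * y)) K 0 hK0
      (fun N k _ => by simpa using hK _) (fun y k hk hy => ?_)
    have hup : ∀ᶠ N in atTop, upCount (stepConfig N (k N)) = k N := by
      filter_upwards [hk] with N hN using upCount_stepConfig hN.2.le
    refine (hφ.tendsto _).comp (tendsto_sqrt_mul_maximizer_sub hp hm h2
      (X := fun N => stepConfig N (k N)) ?_ ?_ ?_)
    · filter_upwards [hk, hup] with N h4 h5
      rw [h5]; exact h4.1
    · filter_upwards [hk, hup] with N h4 h5
      exact hmax N _ (by rw [h5]; exact h4.1) (by rw [h5]; exact h4.2)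
    · refine hy.congr' ?_
      filter_upwards [hup] with N h5
      rw [h5]
  have h4 : Tendsto (fun N : ℕ => ∫ X, φ (√(N : ℝ) * (hHat N X - h)) ∂(model N p β h) -
      ∫ X, g N (upCount X) ∂(model N p β h)) atTop (𝓝 0) := by
    have h5 := (tendsto_integral_extremeIndicator hp hm h2).const_mul (2 * K)
    rw [mul_zero] at h5
    refine squeeze_zero_norm (fun N => ?_) h5
    rw [← integral_sub Integrable.of_finite Integrable.of_finite, ← integral_const_mul]
    refine norm_integral_le_of_norm_le Integrable.of_finite (Eventually.of_forall fun X => ?_)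
    by_cases hX : 0 < upCount X ∧ upCount X < N
    · have hN : 0 < N := hX.1.trans hX.2
      have hup := upCount_stepConfig hX.2.le
      have h6 := (isLikelihoodMaximizer_congr hp hN hup _).mp
        (hmax N (stepConfig N (upCount X)) (by rw [hup]; exact hX.1) (by rw [hup]; exact hX.2))
      have h7 := (hmax N X hX.1 hX.2).unique hX.1 h6
      simp [hg, h7, extremeIndicator, hX]
    · rw [extremeIndicator, if_neg hX, mul_one, Real.norm_eq_abs]
      have h6 := abs_sub (φ (√(N : ℝ) * (hHat N X - h))) (g N (upCount X))
      have h7 := hK (√(N : ℝ) * (hHat N X - h))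
      have h8 : |g N (upCount X)| ≤ K := hK _
      linarith
  have h5 := h4.add h3
  rw [zero_add] at h5
  exact h5.congr fun N => by ring

theorem tendstoInDistribution_mle (hp : 0 < p) (hm : IsUniqueMaximizer p β h m)
    (h2 : H'' p β h m < 0) {hHat : (N : ℕ) → Config N → ℝ}
    (hMLE : ∀ N, IsMLE N p β (hHat N)) :
    TendstoInDistribution (fun (N : ℕ) X => √(N : ℝ) * (hHat N X - h)) atTop id
      (fun N => model N p β h) (gaussianReal 0 (Real.toNNReal (-H'' p β h m))) where
  forall_aemeasurable N := (measurable_of_finite _).aemeasurable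
  tendsto := by
    refine ProbabilityMeasure.tendsto_iff_forall_integral_tendsto.mpr fun φ => ?_
    have hmap : (gaussianReal 0 (limitVar p β h m)).map (-H'' p β h m * ·) =
        gaussianReal 0 (Real.toNNReal (-H'' p β h m)) := by
      rw [gaussianReal_map_const_mul, mul_zero]
      congr 1
      ext
      have : H'' p β h m ≠ 0 := h2.ne
      rw [NNReal.coe_mul, coe_limitVar h2, Real.coe_toNNReal _ (by linarith)]
      simp only [NNReal.coe_mk]
      field_simp
    have h3 := tendsto_integral_comp_mle hp hm h2 hMLE φ.continuous (K := ‖φ‖)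
      fun x => φ.norm_coe_le_norm x
    simp only [ProbabilityMeasure.coe_mk, Measure.map_id]
    rw [← hmap, integral_map (by fun_prop) φ.continuous.aestronglyMeasurable]
    refine h3.congr fun N => ?_
    rw [integral_map (measurable_of_finite _).aemeasurable φ.continuous.aestronglyMeasurable]

/-- A sequence that converges in distribution is bounded in probability. -/
theorem exists_eventually_measureReal_abs_le {Ω : ℕ → Type*} [∀ N, MeasurableSpace (Ω N)]
    {μ : (N : ℕ) → Measure (Ω N)} [∀ N, IsProbabilityMeasure (μ N)] {ν : Measure ℝ}
    [IsProbabilityMeasure ν] {T : (N : ℕ) → Ω N → ℝ}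
    (hT : TendstoInDistribution T atTop id μ ν) {ε : ℝ} (hε : 0 < ε) :
    ∃ M : ℝ, ∀ᶠ N : ℕ in atTop, (μ N).real {X | M < |T N X|} ≤ ε := by
  have hanti : Antitone fun n : ℕ => {x : ℝ | (n : ℝ) ≤ |x|} := fun a b hab x hx => by
    have : (a : ℝ) ≤ b := by exact_mod_cast hab
    exact this.trans hx
  have hmeas : ∀ n : ℕ, MeasurableSet {x : ℝ | (n : ℝ) ≤ |x|} := fun n =>
    measurableSet_le measurable_const measurable_id.abs
  have hν : Tendsto (fun n : ℕ => ν {x : ℝ | (n : ℝ) ≤ |x|}) atTop (𝓝 0) := by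
    have h1 := tendsto_measure_iInter_atTop (μ := ν) (fun n => (hmeas n).nullMeasurableSet) hanti
      ⟨0, measure_ne_top _ _⟩
    have h3 : (⋂ n : ℕ, {x : ℝ | (n : ℝ) ≤ |x|}) = ∅ := by
      ext x
      simp only [Set.mem_iInter, Set.mem_ofPred_eq, Set.mem_empty_iff_false, iff_false, not_forall,
        not_le]
      exact exists_nat_gt |x|
    rwa [h3, measure_empty] at h1
  obtain ⟨n, hn⟩ := (hν.eventually (gt_mem_nhds (ENNReal.ofReal_pos.mpr hε))).exists
  refine ⟨n, ?_⟩
  have hclosed : IsClosed {x : ℝ | (n : ℝ) ≤ |x|} := isClosed_le continuous_const continuous_abs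
  have h4 := ProbabilityMeasure.limsup_measure_closed_le_of_tendsto hT.tendsto hclosed
  simp only [ProbabilityMeasure.coe_mk, Measure.map_id] at h4
  filter_upwards [eventually_lt_of_limsup_lt (h4.trans_lt hn)] with N hN
  rw [Measure.map_apply_of_aemeasurable (hT.forall_aemeasurable N) (hmeas n)] at hN
  refine ENNReal.toReal_le_of_le_ofReal hε.le ((measure_mono fun X hX => ?_).trans hN.le)
  exact (le_of_lt hX : (n : ℝ) ≤ |T N X|)

end

end CurieWeiss

theorem theorem2p2 (p : ℕ) (hp : 3 ≤ p) (β h : ℝ) (hβ : 0 ≤ β)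
    (hreg : CurieWeiss.IsPRegular p β h)
    (m : ℝ) (hm : CurieWeiss.IsUniqueMaximizer p β h m)
    (hHat : (N : ℕ) → CurieWeiss.Config N → ℝ)
    (hMLE : ∀ N, CurieWeiss.IsMLE N p β (hHat N)) :
    -- the ML estimate exists and is unique with probability tending to one
    Tendsto (fun N : ℕ => CurieWeiss.model N p β h
        {X | ∃! h' : ℝ, CurieWeiss.IsLikelihoodMaximizer N p β X h'}) atTop (𝓝 1) ∧
    -- consistency at rate `N ^ (1 / 2)`
    (∀ ε : ℝ, 0 < ε → ∃ M : ℝ, ∀ᶠ N : ℕ in atTop,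
      (CurieWeiss.model N p β h).real {X | M < |√(N : ℝ) * (hHat N X - h)|} ≤ ε) ∧
    -- asymptotic normality
    TendstoInDistribution (fun (N : ℕ) X => √(N : ℝ) * (hHat N X - h)) atTop id
      (fun N => CurieWeiss.model N p β h)
      (gaussianReal 0 (Real.toNNReal (-CurieWeiss.H'' p β h m))) ∧
    -- the limiting variance is positive and is the limiting inverse Fisher information
    0 < -CurieWeiss.H'' p β h m ∧
    Tendsto (fun N : ℕ => (CurieWeiss.fisherInfo N p β h)⁻¹) atTop
      (𝓝 (-CurieWeiss.H'' p β h m)) := by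
  obtain ⟨m', hm', h2'⟩ := hreg
  obtain rfl := hm.unique hm'
  have hp0 : 0 < p := by omega
  have hD := CurieWeiss.tendstoInDistribution_mle hp0 hm h2' hMLE
  exact ⟨CurieWeiss.tendsto_model_existsUnique hp0 hm h2',
    fun ε hε => CurieWeiss.exists_eventually_measureReal_abs_le hD hε, hD, by linarith,
    CurieWeiss.tendsto_inv_fisherInfo hp0 hm h2'⟩
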